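/- For a finite simple graph $\Gamma$ and an odd prime $p$, the Mekler group of $\Gamma$ is $$G_\Gamma=\langle V(\Gamma)\mid x^p=1,\ [[x,y],z]=1\ (x,y,z\in V(\Gamma)),\ [x,y]=1\ (\{x,y\}\in E(\Gamma))\rangle .$$ For a finite simple graph $\Gamma_0$, the graph $\mathrm{CFI}(\Gamma_0)$ is defined as follows. For every vertex $v$ of $\Gamma_0$ and every neighbour $w$ of $v$ there are two external vertices $a^v_w,b^v_w$, and for every vertex $v$ there is one internal vertex for each map $m\colon N(v)\to\{0,1\}$ taking the value $1$ an even number of times. The internal vertex $m$ of $v$ is adjacent, for each $w\in N(v)$, to $a^v_w$ if $m(w)=0$ and to $b^v_w$ if $m(w)=1$. For every edge $\{v,w\}$ of $\Gamma_0$ there are the edges $\{a^v_w,a^w_v\}$ and $\{b^v_w,b^w_v\}$. There are no further edges. The twisted graph $\widetilde{\mathrm{CFI}(\Gamma_0)}$ is obtained by choosing one edge $\{v,w\}$ of $\Gamma_0$ and replacing these two edges by $\{a^v_w,b^w_v\}$ and $\{b^v_w,a^w_v\}$. The $k$-subgroup profile of a finite group $G$ is the multiset of isomorphism types of the $k$-generated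 subgroups of $G$ (the subgroups generated by at most $k$ elements, each subgroup counted once). Let $\Gamma_0$ be a finite connected $3$-regular graph with $N$ edges, let $p$ be an odd prime, and let $G_1$ and $G_2$ be the Mekler groups, with respect to $p$, of $\mathrm{CFI}(\Gamma_0)$ and of $\widetilde{\mathrm{CFI}(\Gamma_0)}$, where any edge of $\Gamma_0$ may be chosen for the twist. Then $G_1$ and $G_2$ have equal $k$-subgroup profiles for every integer $k$ with $0\le k<N/10$; that is, there is a bijection from the $k$-generated subgroups of $G_1$ to those of $G_2$ that maps every subgroup to an isomorphic one. -/

import Mathlib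

universe u v

/-- Vertices of the CFI graphs over `Γ`. The external vertex `Sum.inl (d, x)` lies in the gadget of
`d.fst` and belongs to the edge from `d.fst` to `d.snd`; `x = 0` gives the vertex called `a`,
`x = 1` the one called `b`. The internal vertex `Sum.inr ⟨v, m⟩` is the 0-1-string `m`, indexed by
the neighbours of `v`, with an even number of entries equal to 1. -/
abbrev CFIVertex {V : Type u} (Γ : SimpleGraph V) [Γ.LocallyFinite] : Type u :=
  (Γ.Dart × ZMod 2) ⊕ (Σ v : V, {m : Γ.neighborSet v → ZMod 2 // ∑ w, m w = 0})

/-- The internal vertex `m` of the gadget of `v` is joined to the external vertex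
with bit `m w` of the pair belonging to the edge from `v` to `w`. -/
def CFIGadgetAdj {V : Type u} (Γ : SimpleGraph V) [Γ.LocallyFinite]
    (o : Γ.Dart × ZMod 2) (i : Σ v : V, {m : Γ.neighborSet v → ZMod 2 // ∑ w, m w = 0}) : Prop :=
  ∃ w : Γ.neighborSet i.1, o.1.toProd = (i.1, (w : V)) ∧ i.2.1 w = o.2

/-- External vertices of different gadgets are joined along the edges of `Γ`, in parallel
(`a`-`a`, `b`-`b`) over an edge outside `T`, and crosswise (`a`-`b`, `b`-`a`) over an edge
in `T`. -/
def CFILinkAdj {V : Type u} (Γ : SimpleGraph V) (T : Set (Sym2 V))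
    (o o' : Γ.Dart × ZMod 2) : Prop :=
  o'.1 = o.1.symm ∧ (o.2 = o'.2 ↔ o.1.edge ∉ T)

/-- The CFI graph over `Γ` in which exactly the edges in `T` are twisted. -/
def CFIGraphTwistedAt {V : Type u} (Γ : SimpleGraph V) [Γ.LocallyFinite] (T : Set (Sym2 V)) :
    SimpleGraph (CFIVertex Γ) where
  Adj
    | Sum.inl o, Sum.inl o' => CFILinkAdj Γ T o o'
    | Sum.inl o, Sum.inr i => CFIGadgetAdj Γ o i
    | Sum.inr i, Sum.inl o => CFIGadgetAdj Γ o i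
    | Sum.inr _, Sum.inr _ => False
  symm := by
    refine ⟨?_⟩
    rintro (⟨d, x⟩ | i) (⟨d', y⟩ | j) h
    · obtain ⟨h1, h2⟩ := h
      simp only at h1 h2
      subst h1
      exact ⟨by simp, by simpa [eq_comm] using h2⟩
    · exact h
    · exact h
    · exact h
  loopless := by
    refine ⟨?_⟩
    rintro (⟨d, x⟩ | i) h
    · exact d.symm_ne h.1.symm
    · exact h

/-- The graph `CFI(Γ)`. -/
def CFIGraph {V : Type u} (Γ : SimpleGraph V) [Γ.LocallyFinite] : SimpleGraph (CFIVertex Γ) :=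
  CFIGraphTwistedAt Γ ∅

/-- The twisted CFI graph of `Γ`, with the twist at the edge `e`. -/
def twistedCFIGraph {V : Type u} (Γ : SimpleGraph V) [Γ.LocallyFinite] (e : Sym2 V) :
    SimpleGraph (CFIVertex Γ) :=
  CFIGraphTwistedAt Γ {e}

open scoped commutatorElement in
/-- The relators `x ^ p` and `[[x, y], z]` for all generators, and `[x, y]` for all edges. -/
def meklerRels (p : ℕ) {W : Type u} (Γ : SimpleGraph W) : Set (FreeGroup W) :=
  {r | ∃ x : W, r = FreeGroup.of x ^ p} ∪
  {r | ∃ x y z : W, r = ⁅⁅FreeGroup.of x, FreeGroup.of y⁆, FreeGroup.of z⁆} ∪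
  {r | ∃ x y : W, Γ.Adj x y ∧ r = ⁅FreeGroup.of x, FreeGroup.of y⁆}

/-- The Mekler group of the graph `Γ` with respect to `p`. -/
abbrev MeklerGroup (p : ℕ) {W : Type u} (Γ : SimpleGraph W) : Type u :=
  PresentedGroup (meklerRels p Γ)

/-- The subgroup `S` is generated by `k` elements (repetitions allowed, so by at most `k`). -/
def Subgroup.IsKGenerated {G : Type u} [Group G] (k : ℕ) (S : Subgroup G) : Prop :=
  ∃ g : Fin k → G, Subgroup.closure (Set.range g) = S

/-- `G` and `H` have the same multiset of isomorphism types of `k`-generated subgroups. -/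
def HaveEqualSubgroupProfiles (k : ℕ) (G : Type u) (H : Type v) [Group G] [Group H] : Prop :=
  ∃ Φ : {S : Subgroup G // S.IsKGenerated k} ≃ {S : Subgroup H // S.IsKGenerated k},
    ∀ S, Nonempty (S.1 ≃* (Φ S).1)

open Module

/-! ### Subgroups and partial homomorphisms -/

/-! For odd `p` the Mekler group is the central extension of `F_p^W` by the antisymmetric matrices
vanishing on the edges, with cocycle half of `u ∧ v` masked at the edges (`MeklerGroup.equivModel`).
How a subgroup multiplies depends only on the cocycle on its shadow `U`, the span of its first
components, and a `k`-generated subgroup has `dim U ≤ k`.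

Call an edge of the base graph free for `U` if no vector of `U` has exactly one external vertex in
its support with that vertex over the edge. Isolating vectors for different edges are independent,
so a free edge exists as soon as `dim U < N` (`freeEdges_nonempty`). Twisting a free edge does not
affect `U`: a combination of forms `u ∧ v` with `u, v ∈ U` that one mask kills and the other does
not would have a row in `U` isolating an external vertex over that edge. Hence both masks have the
same kernel on these forms, and the two cocycles on `U` differ by a linear isomorphism of the
centres (`exists_equiv_meklerCocycle_of_mem_freeEdges`). Since the base graph is connected, a flip
then carries the twist to the prescribed edge (`twistMoves_of_connected`).

These isomorphisms vary with `U`, yet must give one bijection of subgroups. Flips preserve the set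
of free edges (`freeEdges_map_flipEquiv`), so choosing the flip as a function of this set alone
makes the induced map on subspaces bijective (`bijective_of_invariant`), and
`BilinExt.haveEqualSubgroupProfiles` lifts this to subgroups. -/

theorem Subgroup.IsKGenerated.of_mulEquiv {G H : Type*} [Group G] [Group H] {k : ℕ}
    {S : Subgroup G} {S' : Subgroup H} (f : S ≃* S') (hS : S.IsKGenerated k) :
    S'.IsKGenerated k := by
  obtain ⟨g, hg⟩ := hS
  have hmem : ∀ i, g i ∈ S := fun i => hg ▸ Subgroup.subset_closure ⟨i, rfl⟩
  let g₀ : Fin k → S := fun i => ⟨g i, hmem i⟩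
  have htop : Subgroup.closure (Set.range g₀) = ⊤ := by
    apply Subgroup.map_injective S.subtype_injective
    rw [MonoidHom.map_closure, ← Set.range_comp, ← MonoidHom.range_eq_map, S.range_subtype]
    exact hg
  refine ⟨fun i => f (g₀ i), ?_⟩
  have := congrArg (Subgroup.map (S'.subtype.comp f.toMonoidHom)) htop
  rw [MonoidHom.map_closure, ← Set.range_comp, ← MonoidHom.range_eq_map,
    MonoidHom.range_comp, MonoidHom.range_eq_top.2 f.surjective, ← MonoidHom.range_eq_map,
    S'.range_subtype] at this
  exact this

/-- An injective map that is multiplicative on a subgroup carries it to an isomorphic subgroup. -/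
theorem Subgroup.exists_coe_eq_image {G H : Type*} [Group G] [Group H] (S : Subgroup G)
    (f : G → H) (hinj : Function.Injective f) (hf : ∀ a ∈ S, ∀ b ∈ S, f (a * b) = f a * f b) :
    ∃ S' : Subgroup H, (S' : Set H) = f '' S ∧ Nonempty (S ≃* S') := by
  let φ : S →* H := MonoidHom.mk' (fun a => f a) fun a b => hf a a.2 b b.2
  have hφ : Function.Injective φ := fun a b h => Subtype.ext (hinj h)
  refine ⟨φ.range, ?_, ⟨φ.ofInjective hφ⟩⟩
  ext y
  simp [φ]

theorem MulEquiv.isKGenerated_mapSubgroup_iff {G H : Type*} [Group G] [Group H] {k : ℕ}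
    (f : G ≃* H) (S : Subgroup G) : S.IsKGenerated k ↔ (f.mapSubgroup S).IsKGenerated k :=
  ⟨.of_mulEquiv (f.subgroupMap S), .of_mulEquiv (f.subgroupMap S).symm⟩

theorem HaveEqualSubgroupProfiles.congr {G G' H H' : Type*} [Group G] [Group G'] [Group H]
    [Group H'] {k : ℕ} (f : G ≃* G') (g : H ≃* H') (h : HaveEqualSubgroupProfiles k G' H') :
    HaveEqualSubgroupProfiles k G H := by
  obtain ⟨Φ, hΦ⟩ := h
  let ef := f.mapSubgroup.toEquiv.subtypeEquiv
    (p := fun S => S.IsKGenerated k) (q := fun S => S.IsKGenerated k)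
    fun S => f.isKGenerated_mapSubgroup_iff S
  let eg := g.mapSubgroup.toEquiv.subtypeEquiv
    (p := fun S => S.IsKGenerated k) (q := fun S => S.IsKGenerated k)
    fun S => g.isKGenerated_mapSubgroup_iff S
  refine ⟨ef.trans (Φ.trans eg.symm), fun S => ?_⟩
  obtain ⟨i⟩ := hΦ (ef S)
  have hS : eg (eg.symm (Φ (ef S))) = Φ (ef S) := eg.apply_symm_apply _
  let j : (eg.symm (Φ (ef S))).1 ≃* (Φ (ef S)).1 :=
    (g.subgroupMap (eg.symm (Φ (ef S))).1).trans
      (MulEquiv.subgroupCongr (congrArg Subtype.val hS))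
  exact ⟨((f.subgroupMap S.1).trans i).trans j.symm⟩

/-! ### Central extensions with bilinear cocycle -/

/-- The central extension of `A` by `C` whose cocycle is the bilinear map `B`. -/
@[ext]
structure BilinExt {R A C : Type*} [CommRing R] [AddCommGroup A] [Module R A] [AddCommGroup C]
    [Module R C] (B : A →ₗ[R] A →ₗ[R] C) where
  fst : A
  snd : C

namespace BilinExt

open scoped commutatorElement

variable {R A C A' C' : Type*} [CommRing R] [AddCommGroup A] [Module R A] [AddCommGroup C]
  [Module R C] [AddCommGroup A'] [Module R A'] [AddCommGroup C'] [Module R C']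
  {B : A →ₗ[R] A →ₗ[R] C} {B' : A' →ₗ[R] A' →ₗ[R] C'}

instance : Mul (BilinExt B) := ⟨fun a b => ⟨a.fst + b.fst, a.snd + b.snd + B a.fst b.fst⟩⟩

instance : One (BilinExt B) := ⟨⟨0, 0⟩⟩

instance : Inv (BilinExt B) := ⟨fun a => ⟨-a.fst, -a.snd + B a.fst a.fst⟩⟩

@[simp] theorem fst_mul (a b : BilinExt B) : (a * b).fst = a.fst + b.fst := rfl

@[simp] theorem snd_mul (a b : BilinExt B) : (a * b).snd = a.snd + b.snd + B a.fst b.fst := rfl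

@[simp] theorem fst_one : (1 : BilinExt B).fst = 0 := rfl

@[simp] theorem snd_one : (1 : BilinExt B).snd = 0 := rfl

@[simp] theorem fst_inv (a : BilinExt B) : a⁻¹.fst = -a.fst := rfl

@[simp] theorem snd_inv (a : BilinExt B) : a⁻¹.snd = -a.snd + B a.fst a.fst := rfl

instance : Group (BilinExt B) :=
  Group.ofLeftAxioms
    (fun a b c => by
      ext
      · simp [add_assoc]
      · simp; abel)
    (fun a => by ext <;> simp)
    (fun a => by ext <;> simp)

/-- The projection to the first component, as a homomorphism. -/
def fstHom (B : A →ₗ[R] A →ₗ[R] C) : BilinExt B →* Multiplicative A where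
  toFun a := .ofAdd a.fst
  map_one' := rfl
  map_mul' _ _ := rfl

theorem commutatorElement_eq (a b : BilinExt B) :
    ⁅a, b⁆ = ⟨0, B a.fst b.fst - B b.fst a.fst⟩ := by
  rw [commutatorElement_def]
  ext
  · simp
  · simp; abel

/-- An alternating cocycle vanishes on multiples of a single vector, so powers pick up no correction
term; over `ZMod p` this gives exponent `p`. -/
theorem pow_eq (hB : B.IsAlt) (a : BilinExt B) (n : ℕ) : a ^ n = ⟨n • a.fst, n • a.snd⟩ := by
  induction n with
  | zero => ext <;> simp
  | succ n ih =>
    rw [pow_succ, ih]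
    have h : B a.fst a.fst = 0 := hB a.fst
    ext
    · simp [add_smul]
    · simp [h, add_smul]

/-- The map of extensions induced by bijections of the two components. -/
def congr (B : A →ₗ[R] A →ₗ[R] C) (B' : A' →ₗ[R] A' →ₗ[R] C') (α : A ≃ₗ[R] A')
    (γ : C ≃ₗ[R] C') : BilinExt B ≃ BilinExt B' where
  toFun a := ⟨α a.fst, γ a.snd⟩
  invFun a := ⟨α.symm a.fst, γ.symm a.snd⟩
  left_inv a := by simp
  right_inv a := by simp

/-- The hypothesis concerns one pair only, because the cocycles will match on a single shadow and
not on the whole space. -/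
theorem congr_mul (α : A ≃ₗ[R] A') (γ : C ≃ₗ[R] C') {a b : BilinExt B}
    (h : γ (B a.fst b.fst) = B' (α a.fst) (α b.fst)) :
    congr B B' α γ (a * b) = congr B B' α γ a * congr B B' α γ b := by
  ext <;> simp [congr, h]

/-- The span of the first components of the elements of a subgroup. -/
def shadow (S : Subgroup (BilinExt B)) : Submodule R A :=
  Submodule.span R (fst '' (S : Set (BilinExt B)))

theorem fst_mem_shadow {S : Subgroup (BilinExt B)} {a : BilinExt B} (ha : a ∈ S) :
    a.fst ∈ shadow S :=
  Submodule.subset_span ⟨a, ha, rfl⟩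

theorem shadow_of_coe_eq_image {S : Subgroup (BilinExt B)} {S' : Subgroup (BilinExt B')}
    {α : A ≃ₗ[R] A'} {γ : C ≃ₗ[R] C'}
    (h : (S' : Set (BilinExt B')) = congr B B' α γ '' S) :
    shadow S' = (shadow S).map (α : A →ₗ[R] A') := by
  rw [shadow, shadow, Submodule.map_span, h, Set.image_image, Set.image_image]
  rfl

theorem finrank_shadow_le {F A C : Type*} [Field F] [AddCommGroup A] [Module F A]
    [AddCommGroup C] [Module F C] {B : A →ₗ[F] A →ₗ[F] C} {k : ℕ} {S : Subgroup (BilinExt B)}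
    (hS : S.IsKGenerated k) : finrank F (shadow S) ≤ k := by
  obtain ⟨g, rfl⟩ := hS
  have hle : shadow (Subgroup.closure (Set.range g)) ≤
      Submodule.span F (Set.range fun i => (g i).fst) := by
    rw [shadow, Submodule.span_le]
    rintro _ ⟨a, ha, rfl⟩
    induction ha using Subgroup.closure_induction with
    | mem x hx =>
      obtain ⟨i, rfl⟩ := hx
      exact Submodule.subset_span ⟨i, rfl⟩
    | one => exact Submodule.zero_mem _
    | mul x y _ _ hx hy => exact Submodule.add_mem _ hx hy
    | inv x _ hx => exact Submodule.neg_mem _ hx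
  have : FiniteDimensional F (Submodule.span F (Set.range fun i => (g i).fst)) :=
    FiniteDimensional.span_of_finite F (Set.finite_range _)
  calc _ ≤ finrank F (Submodule.span F (Set.range fun i => (g i).fst)) :=
        Submodule.finrank_mono hle
    _ ≤ Fintype.card (Fin k) := finrank_range_le_card _
    _ = k := Fintype.card_fin k

/-- Two extensions have equal subgroup profiles if on every small subspace their cocycles agree
up to a linear isomorphism, and these isomorphisms permute the subspaces. -/
theorem haveEqualSubgroupProfiles {F A C A' C' : Type*} [Field F] [AddCommGroup A] [Module F A]
    [AddCommGroup C] [Module F C] [AddCommGroup A'] [Module F A'] [AddCommGroup C'] [Module F C']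
    (B : A →ₗ[F] A →ₗ[F] C) (B' : A' →ₗ[F] A' →ₗ[F] C') (k : ℕ)
    (σ : Submodule F A → A ≃ₗ[F] A')
    (hσ : Function.Bijective fun U : Submodule F A => U.map (σ U : A →ₗ[F] A'))
    (h : ∀ U : Submodule F A, finrank F U ≤ k →
      ∃ γ : C ≃ₗ[F] C', ∀ u ∈ U, ∀ v ∈ U, γ (B u v) = B' (σ U u) (σ U v)) :
    HaveEqualSubgroupProfiles k (BilinExt B) (BilinExt B') := by
  choose γ hγ using h
  have himage : ∀ S : {S : Subgroup (BilinExt B) // S.IsKGenerated k},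
      ∃ S' : {S : Subgroup (BilinExt B') // S.IsKGenerated k},
        (S'.1 : Set (BilinExt B')) = congr B B' (σ (shadow S.1))
          (γ (shadow S.1) (finrank_shadow_le S.2)) '' S.1 ∧ Nonempty (S.1 ≃* S'.1) := by
    intro S
    obtain ⟨S', hS', ⟨i⟩⟩ := S.1.exists_coe_eq_image (congr B B' (σ (shadow S.1))
      (γ (shadow S.1) (finrank_shadow_le S.2))) (Equiv.injective _) fun a ha b hb =>
        congr_mul _ _ (hγ _ _ _ (fst_mem_shadow ha) _ (fst_mem_shadow hb))
    exact ⟨⟨S', S.2.of_mulEquiv i⟩, hS', ⟨i⟩⟩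
  choose Φ hΦ hiso using himage
  refine ⟨Equiv.ofBijective Φ ⟨fun S₁ S₂ h12 => ?_, fun S' => ?_⟩, hiso⟩
  · obtain ⟨S₁, h₁⟩ := S₁
    obtain ⟨S₂, h₂⟩ := S₂
    have e₁ := hΦ ⟨S₁, h₁⟩
    have e₂ := hΦ ⟨S₂, h₂⟩
    -- Equal images have equal shadows, so injectivity on subspaces shows that the same bijection
    -- was applied to both subgroups.
    have hsh : shadow S₁ = shadow S₂ := by
      apply hσ.1
      change (shadow S₁).map _ = (shadow S₂).map _
      rw [← shadow_of_coe_eq_image e₁, ← shadow_of_coe_eq_image e₂, h12]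
    rw [h12, e₂] at e₁
    simp only [hsh] at e₁
    exact Subtype.ext (SetLike.coe_injective ((Equiv.injective _).image_injective e₁)).symm
  · obtain ⟨S', hk⟩ := S'
    -- This `U` is the only possible shadow of a preimage; it fixes the bijection along which `S'`
    -- is pulled back.
    obtain ⟨U, hU⟩ := hσ.2 (shadow S')
    have hUk : finrank F U ≤ k := by
      rw [← (σ U).finrank_map_eq U]
      exact (congrArg (fun U' : Submodule F A' => finrank F U') hU).trans_le (finrank_shadow_le hk)
    have hfst : ∀ a ∈ S', (σ U).symm a.fst ∈ U := fun a ha => by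
      have := fst_mem_shadow ha
      rw [← hU] at this
      obtain ⟨u, hu, hua⟩ := this
      rw [← hua]
      simpa using hu
    obtain ⟨S, hS, ⟨i⟩⟩ := S'.exists_coe_eq_image (congr B B' (σ U) (γ U hUk)).symm
      (Equiv.injective _) fun a ha b hb => by
        rw [Equiv.symm_apply_eq, congr_mul]
        · simp
        · exact hγ _ _ _ (hfst a ha) _ (hfst b hb)
    have hS' : (S' : Set (BilinExt B')) = congr B B' (σ U) (γ U hUk) '' S := by
      rw [hS, Equiv.image_symm_eq_preimage, Equiv.image_preimage]
    have hsh : shadow S = U := by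
      apply Submodule.map_injective_of_injective (σ U).injective
      rw [← shadow_of_coe_eq_image hS']
      exact hU.symm
    subst hsh
    refine ⟨⟨S, hk.of_mulEquiv i⟩, Subtype.ext (SetLike.coe_injective ?_)⟩
    rw [hΦ, hS']

end BilinExt

/-! ### Alternating forms on a graph -/

section Forms

variable (F : Type*) [Field F] {W W' : Type*}

/-- The antisymmetric functions on pairs of vertices that vanish on the edges of `Γ`. -/
def nonedgeForms (Γ : SimpleGraph W) : Submodule F (W × W → F) where
  carrier := {z | (∀ q, z q.swap = -z q) ∧ ∀ q : W × W, Γ.Adj q.1 q.2 → z q = 0}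
  add_mem' := fun {y z} hy hz =>
    ⟨fun q => by simp [hy.1 q, hz.1 q, add_comm], fun q hq => by simp [hy.2 q hq, hz.2 q hq]⟩
  zero_mem' := by simp
  smul_mem' := fun c z hz => ⟨fun q => by simp [hz.1 q], fun q hq => by simp [hz.2 q hq]⟩

/-- The matrix of `u ∧ v`. -/
def wedge : (W → F) →ₗ[F] (W → F) →ₗ[F] nonedgeForms F (⊥ : SimpleGraph W) :=
  LinearMap.mk₂ F
    (fun u v => ⟨fun q => u q.1 * v q.2 - u q.2 * v q.1, fun q => by simp, fun q hq => hq.elim⟩)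
    (fun u u' v => by ext q; simp; ring) (fun c u v => by ext q; simp; ring)
    (fun u v v' => by ext q; simp; ring) (fun c u v => by ext q; simp; ring)

@[simp] theorem wedge_apply (u v : W → F) (q : W × W) :
    (wedge F u v : W × W → F) q = u q.1 * v q.2 - u q.2 * v q.1 := rfl

open scoped Classical in
/-- Replace the entries on the edges of `Γ` by zero. -/
noncomputable def nonedgeMask (Γ : SimpleGraph W) :
    nonedgeForms F (⊥ : SimpleGraph W) →ₗ[F] nonedgeForms F Γ where
  toFun z := ⟨fun q => if Γ.Adj q.1 q.2 then 0 else z.1 q,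
    fun q => by
      by_cases h : Γ.Adj q.1 q.2
      · simp [h, h.symm]
      · have h' : ¬ Γ.Adj q.2 q.1 := fun h' => h h'.symm
        simp [h, h', z.2.1 q],
    fun q hq => by simp [hq]⟩
  map_add' y z := by ext q; by_cases h : Γ.Adj q.1 q.2 <;> simp [h]
  map_smul' c z := by ext q; by_cases h : Γ.Adj q.1 q.2 <;> simp [h]

open scoped Classical in
theorem nonedgeMask_apply (Γ : SimpleGraph W) (z : nonedgeForms F (⊥ : SimpleGraph W))
    (q : W × W) : (nonedgeMask F Γ z : W × W → F) q = if Γ.Adj q.1 q.2 then 0 else z.1 q := rfl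

/-- The cocycle of the Mekler group: half of `u ∧ v`, with the edges removed. -/
noncomputable def meklerCocycle (Γ : SimpleGraph W) :
    (W → F) →ₗ[F] (W → F) →ₗ[F] nonedgeForms F Γ :=
  (2⁻¹ : F) • (wedge F).compr₂ (nonedgeMask F Γ)

theorem meklerCocycle_apply (Γ : SimpleGraph W) (u v : W → F) :
    meklerCocycle F Γ u v = (2⁻¹ : F) • nonedgeMask F Γ (wedge F u v) := rfl

theorem meklerCocycle_isAlt (Γ : SimpleGraph W) : (meklerCocycle F Γ).IsAlt := fun u => by
  have : wedge F u u = 0 := by ext q; simp [mul_comm]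
  rw [meklerCocycle_apply, this, map_zero, smul_zero]

variable {F} in
theorem meklerCocycle_sub_swap (h2 : (2 : F) ≠ 0) (Γ : SimpleGraph W) (u v : W → F) :
    meklerCocycle F Γ u v - meklerCocycle F Γ v u = nonedgeMask F Γ (wedge F u v) := by
  have h : wedge F v u = -wedge F u v := by ext q; simp; ring
  rw [meklerCocycle_apply, meklerCocycle_apply, h, map_neg, smul_neg, sub_neg_eq_add, ← add_smul,
    ← two_mul, mul_inv_cancel₀ h2, one_smul]

/-- A bijection of pairs compatible with swapping and adjacency induces an isomorphism of
spaces of forms. -/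
noncomputable def nonedgeFormsCongr {Γ : SimpleGraph W} {Γ' : SimpleGraph W'}
    (τ : W × W ≃ W' × W') (hswap : ∀ q, τ q.swap = (τ q).swap)
    (hadj : ∀ q, Γ'.Adj (τ q).1 (τ q).2 ↔ Γ.Adj q.1 q.2) :
    nonedgeForms F Γ ≃ₗ[F] nonedgeForms F Γ' :=
  (LinearEquiv.funCongrLeft F F τ.symm).ofSubmodules _ _ <| by
    ext z
    rw [Submodule.mem_map_equiv]
    constructor
    · intro hz
      refine ⟨fun q => ?_, fun q hq => ?_⟩
      · have := hz.1 (τ.symm q)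
        simpa [LinearEquiv.funCongrLeft_apply, LinearMap.funLeft, hswap] using this
      · have := hz.2 (τ.symm q) ((hadj _).1 (by simpa using hq))
        simpa [LinearEquiv.funCongrLeft_apply, LinearMap.funLeft] using this
    · intro hz
      refine ⟨fun q => ?_, fun q hq => ?_⟩
      · have := hz.1 (τ q)
        simpa [LinearEquiv.funCongrLeft_apply, LinearMap.funLeft, hswap] using this
      · exact hz.2 (τ q) ((hadj _).2 hq)

theorem nonedgeFormsCongr_apply {Γ : SimpleGraph W} {Γ' : SimpleGraph W'}
    (τ : W × W ≃ W' × W') (hswap : ∀ q, τ q.swap = (τ q).swap)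
    (hadj : ∀ q, Γ'.Adj (τ q).1 (τ q).2 ↔ Γ.Adj q.1 q.2) (z : nonedgeForms F Γ) (q : W' × W') :
    (nonedgeFormsCongr F τ hswap hadj z : W' × W' → F) q = z.1 (τ.symm q) := rfl

/-- Every form is a combination of the forms `x ∧ y` over the pairs of vertices. -/
theorem sum_smul_nonedgeMask_wedge [Fintype W] [DecidableEq W] (h2 : (2 : F) ≠ 0)
    {Γ : SimpleGraph W} (z : nonedgeForms F Γ) :
    ∑ q : W × W, ((2⁻¹ : F) * z.1 q) •
      nonedgeMask F Γ (wedge F (Pi.single q.1 1) (Pi.single q.2 1)) = z := by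
  ext r
  rw [AddSubmonoidClass.coe_finsetSum, Finset.sum_apply]
  simp only [SetLike.val_smul, Pi.smul_apply, nonedgeMask_apply, wedge_apply, smul_eq_mul]
  by_cases hr : Γ.Adj r.1 r.2
  · simp [hr, z.2.2 r hr]
  · simp only [hr, if_false]
    -- Only `q = r` and `q = r.swap` contribute at `r`, by antisymmetry equally; the factor `2⁻¹`
    -- compensates.
    have h : ∀ q : W × W, 2⁻¹ * z.1 q * ((Pi.single q.1 1 : W → F) r.1 *
        (Pi.single q.2 1 : W → F) r.2 - (Pi.single q.1 1 : W → F) r.2 *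
        (Pi.single q.2 1 : W → F) r.1) =
        (if q = r then 2⁻¹ * z.1 q else 0) - if q = r.swap then 2⁻¹ * z.1 q else 0 := by
      rintro ⟨x, y⟩
      obtain ⟨a, b⟩ := r
      simp only [Pi.single_apply, Prod.mk.injEq, Prod.swap_prod_mk, mul_ite, mul_one, mul_zero,
        mul_sub, ← ite_and, eq_comm (a := a), eq_comm (a := b), and_comm (a := y = b),
        and_comm (a := y = a)]
    rw [Finset.sum_congr rfl fun q _ => h q, Finset.sum_sub_distrib, Finset.sum_ite_eq',
      Finset.sum_ite_eq', if_pos (Finset.mem_univ _), if_pos (Finset.mem_univ _), z.2.1 r]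
    field_simp
    ring

end Forms

/-- Two linear maps with equal kernels, into spaces of equal dimension, differ by an
isomorphism. -/
theorem exists_linearEquiv_comp_eq {F L C C' : Type*} [Field F] [AddCommGroup L] [Module F L]
    [AddCommGroup C] [Module F C] [AddCommGroup C'] [Module F C'] [FiniteDimensional F C]
    (e : C ≃ₗ[F] C') (f : L →ₗ[F] C) (g : L →ₗ[F] C')
    (hker : LinearMap.ker f = LinearMap.ker g) : ∃ γ : C ≃ₗ[F] C', ∀ x, γ (f x) = g x := by
  have : FiniteDimensional F C' := e.finiteDimensional
  -- Equal kernels make both ranges the same quotient of `L`. Their complements have equal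
  -- dimension, so `r` extends to the whole space.
  let r : LinearMap.range f ≃ₗ[F] LinearMap.range g :=
    f.quotKerEquivRange.symm.trans
      ((Submodule.quotEquivOfEq _ _ hker).trans g.quotKerEquivRange)
  have hr : ∀ x, (r ⟨f x, x, rfl⟩ : C') = g x := by
    intro x
    have : f.quotKerEquivRange.symm ⟨f x, x, rfl⟩ = Submodule.Quotient.mk x := by
      rw [LinearEquiv.symm_apply_eq]; rfl
    simp only [r, LinearEquiv.trans_apply, this]
    rfl
  obtain ⟨P, hP⟩ := Submodule.exists_isCompl (LinearMap.range f)
  obtain ⟨Q, hQ⟩ := Submodule.exists_isCompl (LinearMap.range g)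
  have hPQ : finrank F P = finrank F Q := by
    have h1 := Submodule.finrank_add_eq_of_isCompl hP
    have h2 := Submodule.finrank_add_eq_of_isCompl hQ
    have h3 := r.finrank_eq
    have h4 := e.finrank_eq
    omega
  let s := LinearEquiv.ofFinrankEq P Q hPQ
  refine ⟨(Submodule.prodEquivOfIsCompl _ _ hP).symm.trans
    ((r.prodCongr s).trans (Submodule.prodEquivOfIsCompl _ _ hQ)), fun x => ?_⟩
  have : (Submodule.prodEquivOfIsCompl _ _ hP).symm (f x) = (⟨f x, x, rfl⟩, 0) := by
    rw [LinearEquiv.symm_apply_eq]; simp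
  simp only [LinearEquiv.trans_apply, this]
  simp [hr]

/-! ### The Mekler group as a central extension -/

/-- Commuting elements of exponent `p` define a homomorphism from an elementary abelian group. -/
theorem exists_monoidHom_single_eq {p : ℕ} {ι H : Type*} [Fintype ι] [DecidableEq ι] [Group H]
    (h : ι → H) (hcomm : ∀ i j, Commute (h i) (h j)) (hpow : ∀ i, h i ^ p = 1) :
    ∃ ψ : Multiplicative (ι → ZMod p) →* H,
      ∀ i, ψ (.ofAdd (Pi.single i 1)) = h i := by
  let ϕ : ∀ _ : ι, Multiplicative (ZMod p) →* H := fun i =>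
    AddMonoidHom.toMultiplicativeLeft
      (ZMod.lift p ⟨zmultiplesHom (Additive H) (.ofMul (h i)), by
        simpa using congrArg Additive.ofMul (hpow i)⟩)
  have hϕ : ∀ (i : ι) (n : ℤ), ϕ i (.ofAdd (n : ZMod p)) = h i ^ n := fun i n => by
    simp only [ϕ, AddMonoidHom.toMultiplicativeLeft_apply_apply, toAdd_ofAdd, ZMod.lift_coe]
    simp
  have hc : Pairwise fun i j => ∀ x y, Commute (ϕ i x) (ϕ j y) := by
    intro i j _ x y
    obtain ⟨m, hm⟩ := ZMod.intCast_surjective x.toAdd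
    obtain ⟨n, hn⟩ := ZMod.intCast_surjective y.toAdd
    have hx : x = .ofAdd (m : ZMod p) := by rw [hm]; rfl
    have hy : y = .ofAdd (n : ZMod p) := by rw [hn]; rfl
    rw [hx, hy, hϕ, hϕ]
    exact ((hcomm i j).zpow_left m).zpow_right n
  let χ : Multiplicative (ι → ZMod p) →* (ι → Multiplicative (ZMod p)) :=
    ⟨⟨fun a i => .ofAdd (a.toAdd i), rfl⟩, fun _ _ => rfl⟩
  refine ⟨(MonoidHom.noncommPiCoprod ϕ hc).comp χ, fun i => ?_⟩
  have : χ (.ofAdd (Pi.single i 1)) = Pi.mulSingle i (.ofAdd 1) := by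
    ext j
    rcases eq_or_ne j i with rfl | hj
    · simp [χ]
    · simp [χ, hj]
  rw [MonoidHom.comp_apply, this, MonoidHom.noncommPiCoprod_mulSingle]
  simpa using hϕ i 1

namespace MeklerGroup

open scoped commutatorElement

variable {p : ℕ} {W : Type*} {Γ : SimpleGraph W}

/-- The generator of the Mekler group at a vertex. -/
def gen (p : ℕ) (Γ : SimpleGraph W) (x : W) : MeklerGroup p Γ := PresentedGroup.of x

theorem gen_pow (x : W) : gen p Γ x ^ p = 1 := by
  have h : FreeGroup.of x ^ p ∈ meklerRels p Γ := Or.inl (Or.inl ⟨x, rfl⟩)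
  have h' := PresentedGroup.one_of_mem h
  rw [map_pow] at h'
  exact h'

theorem commutator_commutator_gen (x y z : W) : ⁅⁅gen p Γ x, gen p Γ y⁆, gen p Γ z⁆ = 1 := by
  have h : ⁅⁅FreeGroup.of x, FreeGroup.of y⁆, FreeGroup.of z⁆ ∈ meklerRels p Γ :=
    Or.inl (Or.inr ⟨x, y, z, rfl⟩)
  have h' := PresentedGroup.one_of_mem h
  simp only [map_commutatorElement] at h'
  exact h'

theorem commutator_gen_of_adj {x y : W} (hxy : Γ.Adj x y) : ⁅gen p Γ x, gen p Γ y⁆ = 1 := by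
  have h : ⁅FreeGroup.of x, FreeGroup.of y⁆ ∈ meklerRels p Γ := Or.inr ⟨x, y, hxy, rfl⟩
  have h' := PresentedGroup.one_of_mem h
  simp only [map_commutatorElement] at h'
  exact h'

theorem commutator_gen_mem_center (x y : W) :
    ⁅gen p Γ x, gen p Γ y⁆ ∈ Subgroup.center (MeklerGroup p Γ) := by
  have h : ∀ g, g ∈ Subgroup.centralizer {⁅gen p Γ x, gen p Γ y⁆} :=
    PresentedGroup.generated_by _ _ fun z => by
      rw [Subgroup.mem_centralizer_singleton_iff]
      exact (commutatorElement_eq_one_iff_mul_comm.1 (commutator_commutator_gen x y z)).symm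
  exact Subgroup.mem_center_iff.2 fun g => Subgroup.mem_centralizer_singleton_iff.1 (h g)

/-- Conjugation by `x` multiplies `y` by the central element `c = ⁅x, y⁆`; taking `p`-th powers
gives `1 = c ^ p`. -/
theorem commutator_gen_pow (x y : W) : ⁅gen p Γ x, gen p Γ y⁆ ^ p = 1 := by
  have hc : ∀ g, Commute g ⁅gen p Γ x, gen p Γ y⁆ :=
    fun g => Subgroup.mem_center_iff.1 (commutator_gen_mem_center x y) g
  have hconj : gen p Γ x * gen p Γ y * (gen p Γ x)⁻¹ = ⁅gen p Γ x, gen p Γ y⁆ * gen p Γ y := by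
    rw [commutatorElement_def]; group
  have h := congrArg (· ^ p) hconj
  simp only [conj_pow, gen_pow, mul_one, mul_inv_cancel, (hc _).symm.mul_pow] at h
  exact h.symm

/-- The subgroup generated by the commutators of the generators. -/
def commutatorGens (p : ℕ) (Γ : SimpleGraph W) : Subgroup (MeklerGroup p Γ) :=
  Subgroup.closure (Set.range fun q : W × W => ⁅gen p Γ q.1, gen p Γ q.2⁆)

theorem commutatorGens_le_center : commutatorGens p Γ ≤ Subgroup.center (MeklerGroup p Γ) := by
  rw [commutatorGens, Subgroup.closure_le]
  rintro _ ⟨q, rfl⟩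
  exact commutator_gen_mem_center _ _

instance : (commutatorGens p Γ).Normal :=
  ⟨fun n hn g => by
    rw [Subgroup.mem_center_iff.1 (commutatorGens_le_center hn) g, mul_inv_cancel_right]
    exact hn⟩

section

variable [Fact p.Prime]

theorem two_ne_zero_of_ne_two (hodd : p ≠ 2) : (2 : ZMod p) ≠ 0 := fun h => by
  have hdvd := (ZMod.natCast_eq_zero_iff 2 p).1 (by exact_mod_cast h)
  exact hodd ((Nat.prime_dvd_prime_iff_eq Fact.out Nat.prime_two).1 hdvd)

theorem nonedgeMask_wedge_single_of_adj [DecidableEq W] {F : Type*} [Field F] {x y : W}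
    (hxy : Γ.Adj x y) :
    nonedgeMask F Γ (wedge F (Pi.single x 1) (Pi.single y 1)) = 0 := by
  ext ⟨a, b⟩
  simp only [nonedgeMask_apply, wedge_apply, Pi.single_apply]
  by_cases h : Γ.Adj a b
  · simp [h]
  · have h1 : ¬ (a = x ∧ b = y) := fun ⟨h1, h2⟩ => h (h1 ▸ h2 ▸ hxy)
    have h2 : ¬ (b = x ∧ a = y) := fun ⟨h1, h2⟩ => h (h1 ▸ h2 ▸ hxy.symm)
    simp only [h, if_false, mul_ite, mul_one, mul_zero, ← ite_and]
    rw [if_neg (fun h => h1 h.symm), if_neg (fun h => h2 h.symm)]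
    simp

/-- Antisymmetrising the cocycle doubles it, which cancels its factor `2⁻¹`. -/
theorem commutator_model (hodd : p ≠ 2) (a b : BilinExt (meklerCocycle (ZMod p) Γ)) :
    ⁅a, b⁆ = ⟨0, nonedgeMask (ZMod p) Γ (wedge (ZMod p) a.fst b.fst)⟩ := by
  rw [BilinExt.commutatorElement_eq, meklerCocycle_sub_swap (two_ne_zero_of_ne_two hodd)]

variable [DecidableEq W]

/-- The homomorphism from the Mekler group to the central extension. -/
noncomputable def toModel (Γ : SimpleGraph W) (hodd : p ≠ 2) :
    MeklerGroup p Γ →* BilinExt (meklerCocycle (ZMod p) Γ) :=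
  PresentedGroup.toGroup (f := fun x => ⟨Pi.single x 1, 0⟩) <| by
    rintro r ((⟨x, rfl⟩ | ⟨x, y, z, rfl⟩) | ⟨x, y, hxy, rfl⟩)
    · rw [map_pow, FreeGroup.lift_apply_of, BilinExt.pow_eq (meklerCocycle_isAlt _ _)]
      ext <;> simp
    · simp only [map_commutatorElement, FreeGroup.lift_apply_of, commutator_model hodd]
      ext <;> simp
    · simp only [map_commutatorElement, FreeGroup.lift_apply_of, commutator_model hodd,
        nonedgeMask_wedge_single_of_adj hxy]
      rfl

theorem toModel_gen (hodd : p ≠ 2) (x : W) : toModel Γ hodd (gen p Γ x) = ⟨Pi.single x 1, 0⟩ :=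
  PresentedGroup.toGroup.of _

theorem toModel_commutator (hodd : p ≠ 2) (x y : W) :
    toModel Γ hodd ⁅gen p Γ x, gen p Γ y⁆ =
      ⟨0, nonedgeMask (ZMod p) Γ (wedge (ZMod p) (Pi.single x 1) (Pi.single y 1))⟩ := by
  rw [map_commutatorElement, toModel_gen, toModel_gen, commutator_model hodd]

variable [Fintype W]

/-- Modulo the commutators the generators commute and have exponent `p`, so the quotient map factors
through the first component of the model. -/
theorem mem_commutatorGens_of_fst_eq_zero (hodd : p ≠ 2) {g : MeklerGroup p Γ}
    (hg : (toModel Γ hodd g).fst = 0) : g ∈ commutatorGens p Γ := by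
  obtain ⟨ψ, hψ⟩ := exists_monoidHom_single_eq (p := p)
    (fun x : W => (QuotientGroup.mk (gen p Γ x) : MeklerGroup p Γ ⧸ commutatorGens p Γ))
    (fun x y => by
      rw [← commutatorElement_eq_one_iff_commute]
      exact (QuotientGroup.eq_one_iff _).2 (Subgroup.subset_closure ⟨(x, y), rfl⟩))
    (fun x => by rw [← QuotientGroup.mk_pow, gen_pow]; rfl)
  have h : (ψ.comp (BilinExt.fstHom _)).comp (toModel Γ hodd) =
      QuotientGroup.mk' (commutatorGens p Γ) := by
    apply PresentedGroup.ext
    intro x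
    change ψ (.ofAdd (toModel Γ hodd (gen p Γ x)).fst) = _
    rw [toModel_gen]
    exact hψ x
  rw [← QuotientGroup.eq_one_iff]
  have h' := DFunLike.congr_fun h g
  refine h'.symm.trans ?_
  change ψ (.ofAdd (toModel Γ hodd g).fst) = 1
  rw [hg]
  exact map_one ψ

/-- A kernel element lies in `commutatorGens`, where it can be recovered from its matrix: `ψ` sends
each pair of vertices to its commutator. -/
theorem toModel_injective (hodd : p ≠ 2) : Function.Injective (toModel Γ hodd) := by
  obtain ⟨ψ, hψ⟩ := exists_monoidHom_single_eq (p := p)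
    (fun q : W × W => ⁅gen p Γ q.1, gen p Γ q.2⁆)
    (fun q r => Subgroup.mem_center_iff.1 (commutator_gen_mem_center _ _) _)
    (fun q => commutator_gen_pow _ _)
  let z (g : MeklerGroup p Γ) : W × W → ZMod p := (toModel Γ hodd g).snd.1
  have key : ∀ g ∈ commutatorGens p Γ, (toModel Γ hodd g).fst = 0 ∧
      ψ (.ofAdd ((2⁻¹ : ZMod p) • z g)) = g := by
    intro g hg
    induction hg using Subgroup.closure_induction with
    | mem g hg =>
      obtain ⟨q, rfl⟩ := hg
      refine ⟨by simp only [toModel_commutator], ?_⟩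
      by_cases hq : Γ.Adj q.1 q.2
      · simp [z, commutator_gen_of_adj hq]
      · have hz : z ⁅gen p Γ q.1, gen p Γ q.2⁆ =
            Pi.single q 1 - Pi.single q.swap 1 := by
          simp only [z, toModel_commutator]
          ext ⟨a, b⟩
          obtain ⟨x, y⟩ := q
          simp only [nonedgeMask_apply, wedge_apply, Pi.single_apply, Pi.sub_apply,
            Prod.mk.injEq, Prod.swap_prod_mk, mul_ite, mul_one, mul_zero, ← ite_and]
          by_cases hab : Γ.Adj a b
          · have h1 : ¬ (a = x ∧ b = y) := fun ⟨h1, h2⟩ => hq (h1 ▸ h2 ▸ hab)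
            have h2 : ¬ (a = y ∧ b = x) := fun ⟨h1, h2⟩ => hq (h1 ▸ h2 ▸ hab.symm)
            rw [if_pos hab, if_neg h1, if_neg h2, sub_zero]
          · simp only [if_neg hab, and_comm]
        -- The entries at `q` and `q.swap` are opposite and belong to inverse commutators, so the
        -- matrix gives each commutator twice.
        have hswap : ψ (.ofAdd (z ⁅gen p Γ q.1, gen p Γ q.2⁆)) =
            ψ (.ofAdd ((2 : ZMod p) • Pi.single q 1)) := by
          rw [hz, sub_eq_add_neg, ofAdd_add, ofAdd_neg, map_mul, map_inv, hψ, hψ, two_smul,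
            ofAdd_add, map_mul, hψ, Prod.fst_swap, Prod.snd_swap, commutatorElement_inv]
        obtain ⟨n, hn⟩ := ZMod.natCast_zmod_surjective (2⁻¹ : ZMod p)
        have hsmul : ∀ u : W × W → ZMod p,
            ψ (.ofAdd ((2⁻¹ : ZMod p) • u)) = ψ (.ofAdd u) ^ n := fun u => by
          rw [← hn, Nat.cast_smul_eq_nsmul, ofAdd_nsmul, map_pow]
        rw [hsmul, hswap, ← hsmul, smul_smul, inv_mul_cancel₀ (two_ne_zero_of_ne_two hodd),
          one_smul, hψ]
    | one => simp [z]
    | mul g h _ _ hg hh =>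
      refine ⟨by simp [hg.1, hh.1], ?_⟩
      have : z (g * h) = z g + z h := by simp [z, hg.1]
      rw [this, smul_add, ofAdd_add, map_mul, hg.2, hh.2]
    | inv g _ hg =>
      refine ⟨by simp [hg.1], ?_⟩
      have : z g⁻¹ = -z g := by simp [z, hg.1]
      rw [this, smul_neg, ofAdd_neg, map_inv, hg.2]
  rw [injective_iff_map_eq_one]
  intro g hg
  have := (key g (mem_commutatorGens_of_fst_eq_zero hodd (by rw [hg]; rfl))).2
  simpa [z, hg] using this.symm

/-- Additive subgroups over `ZMod p` are subspaces, so it suffices to reach spanning sets: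
commutators for the centre, generators for the first component. -/
theorem toModel_surjective (hodd : p ≠ 2) : Function.Surjective (toModel Γ hodd) := by
  let R := (toModel Γ hodd).range
  have hsnd : ∀ z, (⟨0, z⟩ : BilinExt (meklerCocycle (ZMod p) Γ)) ∈ R := by
    let N : AddSubgroup (nonedgeForms (ZMod p) Γ) :=
      { carrier := {z | (⟨0, z⟩ : BilinExt (meklerCocycle (ZMod p) Γ)) ∈ R}
        zero_mem' := R.one_mem
        add_mem' := fun {y z} hy hz => by
          have h : (⟨0, y + z⟩ : BilinExt (meklerCocycle (ZMod p) Γ)) = ⟨0, y⟩ * ⟨0, z⟩ := by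
            ext <;> simp
          rw [Set.mem_ofPred_eq, h]
          exact R.mul_mem hy hz
        neg_mem' := fun {z} hz => by
          have h : (⟨0, -z⟩ : BilinExt (meklerCocycle (ZMod p) Γ)) = ⟨0, z⟩⁻¹ := by
            ext <;> simp
          rw [Set.mem_ofPred_eq, h]
          exact R.inv_mem hz }
    intro z
    change z ∈ AddSubgroup.toZModSubmodule p N
    rw [← sum_smul_nonedgeMask_wedge (ZMod p) (two_ne_zero_of_ne_two hodd) z]
    refine Submodule.sum_mem _ fun q _ => Submodule.smul_mem _ _ ?_
    exact ⟨_, toModel_commutator hodd q.1 q.2⟩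
  have hfst : ∀ u : W → ZMod p, ∃ a ∈ R, a.fst = u := by
    let N : AddSubgroup (W → ZMod p) :=
      { carrier := {u | ∃ a ∈ R, a.fst = u}
        zero_mem' := ⟨1, R.one_mem, rfl⟩
        add_mem' := by
          rintro _ _ ⟨a, ha, rfl⟩ ⟨b, hb, rfl⟩
          exact ⟨a * b, R.mul_mem ha hb, rfl⟩
        neg_mem' := by
          rintro _ ⟨a, ha, rfl⟩
          exact ⟨a⁻¹, R.inv_mem ha, rfl⟩ }
    intro u
    change u ∈ AddSubgroup.toZModSubmodule p N
    rw [pi_eq_sum_univ' u]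
    refine Submodule.sum_mem _ fun x _ => Submodule.smul_mem _ _ ?_
    refine ⟨_, ⟨gen p Γ x, rfl⟩, ?_⟩
    rw [toModel_gen]
  rintro ⟨u, z⟩
  obtain ⟨a, ha, rfl⟩ := hfst u
  have h : (⟨a.fst, z⟩ : BilinExt (meklerCocycle (ZMod p) Γ)) = a * ⟨0, z - a.snd⟩ := by
    ext <;> simp
  rw [h]
  exact R.mul_mem ha (hsnd (z - a.snd))

/-- The Mekler group is a central extension with bilinear cocycle. -/
noncomputable def equivModel (Γ : SimpleGraph W) (hodd : p ≠ 2) :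
    MeklerGroup p Γ ≃* BilinExt (meklerCocycle (ZMod p) Γ) :=
  MulEquiv.ofBijective (toModel Γ hodd) ⟨toModel_injective hodd, toModel_surjective hodd⟩

end

end MeklerGroup

/-! ### Flips of CFI graphs -/

section Flips

variable {V : Type*} {Γ : SimpleGraph V}

/-- In this additive form, shifting the bits by `f` changes the twist at `d` by `f d + f d.symm`. -/
theorem cfiLinkAdj_iff {T : Set (Sym2 V)} {o o' : Γ.Dart × ZMod 2} :
    CFILinkAdj Γ T o o' ↔
      o'.1 = o.1.symm ∧ o.2 + o'.2 = T.indicator (1 : Sym2 V → ZMod 2) o.1.edge := by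
  have h0 : ∀ a b : ZMod 2, a = b ↔ a + b = 0 := by decide
  have h1 : ∀ a b : ZMod 2, ¬ a = b ↔ a + b = 1 := by decide
  by_cases h : o.1.edge ∈ T
  · simp [CFILinkAdj, h, h1]
  · simp [CFILinkAdj, h, h0]

/-- Swap the external vertices `a` and `b` of the darts with `f d = 1`. -/
def shiftBit (f : Γ.Dart → ZMod 2) (o : Γ.Dart × ZMod 2) : Γ.Dart × ZMod 2 := (o.1, o.2 + f o.1)

@[simp] theorem shiftBit_shiftBit (f : Γ.Dart → ZMod 2) (o : Γ.Dart × ZMod 2) :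
    shiftBit f (shiftBit f o) = o := by
  simp [shiftBit, add_assoc, CharTwo.add_self_eq_zero]

theorem cfiLinkAdj_shiftBit_iff {T T' : Set (Sym2 V)} {f : Γ.Dart → ZMod 2}
    (hf : ∀ d, f d + f d.symm = T.indicator 1 d.edge + T'.indicator 1 d.edge)
    (o o' : Γ.Dart × ZMod 2) :
    CFILinkAdj Γ T' (shiftBit f o) (shiftBit f o') ↔ CFILinkAdj Γ T o o' := by
  rw [cfiLinkAdj_iff, cfiLinkAdj_iff]
  refine and_congr_right fun h => ?_
  have h' : o'.1 = o.1.symm := h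
  have key : ∀ a b s s' t t' : ZMod 2, s + s' = t + t' →
      (a + s + (b + s') = t' ↔ a + b = t) := by decide
  simpa [shiftBit, h'] using key o.2 o'.2 _ _ _ _ (hf o.1)

open scoped Classical in
/-- The indicator function of the dart from `v` to `w`. -/
noncomputable def dartIndicator (v w : V) (d : Γ.Dart) : ZMod 2 :=
  if d.toProd = (v, w) then 1 else 0

theorem dartIndicator_add_symm {v w : V} (h : Γ.Adj v w) (d : Γ.Dart) :
    dartIndicator v w d + dartIndicator v w d.symm =
      ({s(v, w)} : Set (Sym2 V)).indicator 1 d.edge := by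
  classical
  obtain ⟨⟨x, y⟩, -⟩ := d
  have hvw := h.ne
  simp only [dartIndicator, SimpleGraph.Dart.symm, Prod.swap_prod_mk, Prod.mk.injEq,
    Set.indicator_apply, Set.mem_singleton_iff, SimpleGraph.Dart.edge, Sym2.eq_iff, Pi.one_apply]
  grind

/-- Shift the bits of pairs of external vertices, and fix all other pairs of vertices. -/
def shiftPairs [Γ.LocallyFinite] (f : Γ.Dart → ZMod 2) :
    CFIVertex Γ × CFIVertex Γ ≃ CFIVertex Γ × CFIVertex Γ :=
  Function.Involutive.toPerm
    (fun q => match q with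
      | (Sum.inl o, Sum.inl o') => (Sum.inl (shiftBit f o), Sum.inl (shiftBit f o'))
      | (Sum.inl o, Sum.inr i) => (Sum.inl o, Sum.inr i)
      | (Sum.inr i, Sum.inl o) => (Sum.inr i, Sum.inl o)
      | (Sum.inr i, Sum.inr j) => (Sum.inr i, Sum.inr j)) <| by
    rintro ⟨o | i, o' | j⟩ <;> simp

/-- The spaces of forms of a CFI graph and of the graph with one more twist are isomorphic. -/
theorem nonempty_nonedgeForms_equiv [Γ.LocallyFinite] (F : Type*) [Field F] {e : Sym2 V}
    (he : e ∈ Γ.edgeSet) :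
    Nonempty (nonedgeForms F (CFIGraph Γ) ≃ₗ[F] nonedgeForms F (twistedCFIGraph Γ e)) := by
  induction e with | _ v w
  have hf : ∀ d : Γ.Dart, dartIndicator v w d + dartIndicator v w d.symm =
      (∅ : Set (Sym2 V)).indicator 1 d.edge +
        ({s(v, w)} : Set (Sym2 V)).indicator 1 d.edge := fun d => by
    rw [dartIndicator_add_symm he, Set.indicator_empty, zero_add]
  -- A single dart is not an even flip, so internal vertices cannot follow it. Permuting pairs
  -- instead of vertices avoids this, and suffices to compare dimensions.
  refine ⟨nonedgeFormsCongr F (shiftPairs (dartIndicator v w)) ?_ ?_⟩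
  · rintro ⟨o | i, o' | j⟩ <;> rfl
  · rintro ⟨o | i, o' | j⟩
    · exact cfiLinkAdj_shiftBit_iff hf o o'
    all_goals exact Iff.rfl

variable [Γ.LocallyFinite]

/-- A set of darts that contains an even number of darts from every vertex. -/
def IsEvenFlip (f : Γ.Dart → ZMod 2) : Prop :=
  ∀ v, ∑ w : Γ.neighborSet v, f ⟨(v, w), w.2⟩ = 0

/-- The permutation of the vertices of CFI graphs that flips the darts with `f d = 1`. -/
def cfiFlip (f : Γ.Dart → ZMod 2) (hf : IsEvenFlip f) : CFIVertex Γ ≃ CFIVertex Γ :=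
  Function.Involutive.toPerm
    (Sum.map (shiftBit f) fun i => ⟨i.1, fun w => i.2.1 w + f ⟨(i.1, w), w.2⟩, by
      rw [Finset.sum_add_distrib, i.2.2, hf, add_zero]⟩) <| by
    rintro (o | ⟨v, m, hm⟩)
    · simp
    · simp [add_assoc, CharTwo.add_self_eq_zero]

theorem cfiFlip_symm (f : Γ.Dart → ZMod 2) (hf : IsEvenFlip f) :
    (cfiFlip f hf).symm = cfiFlip f hf := rfl

theorem cfiFlip_inl (f : Γ.Dart → ZMod 2) (hf : IsEvenFlip f) (o : Γ.Dart × ZMod 2) :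
    cfiFlip f hf (Sum.inl o) = Sum.inl (shiftBit f o) := rfl

theorem cfiFlip_gadgetAdj (f : Γ.Dart → ZMod 2) (o : Γ.Dart × ZMod 2)
    (v : V) (m m' : {m : Γ.neighborSet v → ZMod 2 // ∑ w, m w = 0})
    (hm : ∀ w, m'.1 w = m.1 w + f ⟨(v, w), w.2⟩) :
    CFIGadgetAdj Γ (shiftBit f o) ⟨v, m'⟩ ↔ CFIGadgetAdj Γ o ⟨v, m⟩ := by
  refine exists_congr fun w => and_congr_right fun h => ?_
  have h' : o.1 = ⟨(v, w), w.2⟩ := SimpleGraph.Dart.ext _ _ h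
  rw [hm w]
  simp only [shiftBit]
  rw [← h', add_left_inj]

/-- Internal vertices move along with the external ones, so gadgets are preserved and only links
between gadgets see the change of twist. -/
theorem cfiFlip_adj_iff {T T' : Set (Sym2 V)} {f : Γ.Dart → ZMod 2} (heven : IsEvenFlip f)
    (hf : ∀ d, f d + f d.symm = T.indicator 1 d.edge + T'.indicator 1 d.edge)
    (x y : CFIVertex Γ) :
    (CFIGraphTwistedAt Γ T').Adj (cfiFlip f heven x) (cfiFlip f heven y) ↔
      (CFIGraphTwistedAt Γ T).Adj x y := by
  rcases x with o | ⟨v, m⟩ <;> rcases y with o' | ⟨v', m'⟩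
  · exact cfiLinkAdj_shiftBit_iff hf o o'
  · exact cfiFlip_gadgetAdj f o v' m' _ fun w => rfl
  · exact cfiFlip_gadgetAdj f o' v m _ fun w => rfl
  · exact Iff.rfl

variable (Γ) in
/-- Flipping an even number of darts at every vertex moves the twist from `e` to `e'`. -/
def TwistMoves (e e' : Sym2 V) : Prop :=
  ∃ f : Γ.Dart → ZMod 2, IsEvenFlip f ∧ ∀ d : Γ.Dart, f d + f d.symm =
    ({e} : Set (Sym2 V)).indicator 1 d.edge + ({e'} : Set (Sym2 V)).indicator 1 d.edge

theorem TwistMoves.trans {e₁ e₂ e₃ : Sym2 V} (h : TwistMoves Γ e₁ e₂) (h' : TwistMoves Γ e₂ e₃) :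
    TwistMoves Γ e₁ e₃ := by
  obtain ⟨f, hf, hf'⟩ := h
  obtain ⟨g, hg, hg'⟩ := h'
  refine ⟨f + g, fun v => ?_, fun d => ?_⟩
  · simp only [Pi.add_apply]
    rw [Finset.sum_add_distrib, hf, hg, add_zero]
  · have h := congrArg₂ (· + ·) (hf' d) (hg' d)
    have key : ∀ a b c : ZMod 2, a + b + (b + c) = a + c := by decide
    simp only [key] at h
    rw [← h]
    simp only [Pi.add_apply]
    ring

theorem sum_dartIndicator {v w : V} (h : Γ.Adj v w) (x : V) [Decidable (x = v)] :
    ∑ z : Γ.neighborSet x, dartIndicator v w (⟨(x, z), z.2⟩ : Γ.Dart) = if x = v then 1 else 0 := by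
  by_cases hx : x = v
  · subst hx
    rw [Finset.sum_eq_single ⟨w, h⟩]
    · simp [dartIndicator]
    · intro z _ hz
      have : (z : V) ≠ w := fun h => hz (Subtype.ext h)
      simp [dartIndicator, this]
    · simp
  · simp [dartIndicator, hx]

/-- Flip the two darts leaving `v`: two flips at `v`, none at other vertices. For `w = w'` they
cancel. -/
theorem twistMoves_of_adj {v w w' : V} (h : Γ.Adj v w) (h' : Γ.Adj v w') :
    TwistMoves Γ s(v, w) s(v, w') := by
  classical
  refine ⟨dartIndicator v w + dartIndicator v w', fun x => ?_, fun d => ?_⟩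
  · simp only [Pi.add_apply]
    rw [Finset.sum_add_distrib, sum_dartIndicator h, sum_dartIndicator h']
    exact CharTwo.add_self_eq_zero _
  · rw [← dartIndicator_add_symm h, ← dartIndicator_add_symm h']
    simp only [Pi.add_apply]
    ring

/-- The twist is pushed along a walk, one vertex at a time. -/
theorem twistMoves_of_connected (hconn : Γ.Connected) {e e' : Sym2 V} (he : e ∈ Γ.edgeSet)
    (he' : e' ∈ Γ.edgeSet) : TwistMoves Γ e e' := by
  induction e with | _ v w
  induction e' with | _ v' w'
  rw [SimpleGraph.mem_edgeSet] at he he'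
  obtain ⟨q⟩ := hconn.preconnected v v'
  induction q generalizing w with
  | nil => exact twistMoves_of_adj he he'
  | cons hadj _ ih =>
    have h := ih _ hadj.symm he'
    rw [Sym2.eq_swap] at h
    exact (twistMoves_of_adj he hadj).trans h

end Flips

/-! ### Free edges -/

section FreeEdges

variable {V : Type*} {Γ : SimpleGraph V} [Γ.LocallyFinite] {F : Type*} [Field F]

/-- Among the external vertices, `u` is supported at `o` only. -/
def Isolates (u : CFIVertex Γ → F) (o : Γ.Dart × ZMod 2) : Prop :=
  u (Sum.inl o) ≠ 0 ∧ ∀ r, r ≠ o → u (Sum.inl r) = 0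

/-- The edges of `Γ` none of whose external vertices is isolated by a vector in `U`. -/
def freeEdges (U : Submodule F (CFIVertex Γ → F)) : Set (Sym2 V) :=
  {e | e ∈ Γ.edgeSet ∧ ∀ u ∈ U, ∀ o, Isolates u o → o.1.edge ≠ e}

/-- The action of a flip on vectors. -/
def flipEquiv (F : Type*) [Field F] (f : Γ.Dart → ZMod 2) (hf : IsEvenFlip f) :
    (CFIVertex Γ → F) ≃ₗ[F] (CFIVertex Γ → F) :=
  LinearEquiv.funCongrLeft F F (cfiFlip f hf).symm

theorem flipEquiv_apply (f : Γ.Dart → ZMod 2) (hf : IsEvenFlip f) (u : CFIVertex Γ → F)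
    (x : CFIVertex Γ) : flipEquiv F f hf u x = u ((cfiFlip f hf).symm x) := rfl

theorem flipEquiv_flipEquiv (f : Γ.Dart → ZMod 2) (hf : IsEvenFlip f) (u : CFIVertex Γ → F) :
    flipEquiv F f hf (flipEquiv F f hf u) = u := by
  ext x
  rw [flipEquiv_apply, flipEquiv_apply, cfiFlip_symm]
  congr 1
  exact (cfiFlip f hf).symm_apply_apply x

theorem isolates_of_flipEquiv {f : Γ.Dart → ZMod 2} {hf : IsEvenFlip f} {u : CFIVertex Γ → F}
    {o : Γ.Dart × ZMod 2} (h : Isolates (flipEquiv F f hf u) o) : Isolates u (shiftBit f o) := by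
  refine ⟨h.1, fun o' ho' => ?_⟩
  have := h.2 (shiftBit f o') fun h => ho' (by rw [← h, shiftBit_shiftBit])
  rwa [flipEquiv_apply, cfiFlip_symm, cfiFlip_inl, shiftBit_shiftBit] at this

/-- A flip moves external vertices only within their dart, so an isolated vertex stays over the same
edge; the reverse inclusion holds because flips are involutions. -/
theorem freeEdges_map_flipEquiv (f : Γ.Dart → ZMod 2) (hf : IsEvenFlip f)
    (U : Submodule F (CFIVertex Γ → F)) :
    freeEdges (U.map (flipEquiv F f hf : (CFIVertex Γ → F) →ₗ[F] (CFIVertex Γ → F))) =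
      freeEdges U := by
  have key : ∀ U : Submodule F (CFIVertex Γ → F), freeEdges U ⊆
      freeEdges (U.map (flipEquiv F f hf : (CFIVertex Γ → F) →ₗ[F] (CFIVertex Γ → F))) := by
    rintro U e ⟨he, hU⟩
    refine ⟨he, ?_⟩
    rintro _ ⟨u, hu, rfl⟩ o ho
    exact hU u hu (shiftBit f o) (isolates_of_flipEquiv ho)
  refine (key U).antisymm' ?_
  have hcomp : (flipEquiv F f hf : (CFIVertex Γ → F) →ₗ[F] (CFIVertex Γ → F)) ∘ₗ
      (flipEquiv F f hf : (CFIVertex Γ → F) →ₗ[F] (CFIVertex Γ → F)) = LinearMap.id :=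
    LinearMap.ext fun u => flipEquiv_flipEquiv f hf u
  have h := key (U.map (flipEquiv F f hf : (CFIVertex Γ → F) →ₗ[F] (CFIVertex Γ → F)))
  rwa [← Submodule.map_comp, hcomp, Submodule.map_id] at h

/-- Otherwise each edge has a vector of `U` isolating a vertex over it. Evaluation at these distinct
vertices shows that the vectors are independent, so `dim U` is at least the number of edges. -/
theorem freeEdges_nonempty [Finite V] {U : Submodule F (CFIVertex Γ → F)}
    (hU : finrank F U < Nat.card Γ.edgeSet) : (freeEdges U).Nonempty := by
  classical
  have : Finite Γ.Dart := Finite.of_injective _ SimpleGraph.Dart.toProd_injective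
  by_contra hempty
  have h : ∀ e : Γ.edgeSet, ∃ u : U, ∃ o, Isolates u.1 o ∧ o.1.edge = e := by
    intro e
    by_contra! hcon
    exact hempty ⟨e, e.2, fun u hu o ho => hcon ⟨u, hu⟩ o ho⟩
  choose u o ho hoe using h
  have hinj : Function.Injective o := fun e e' h => Subtype.ext (by rw [← hoe, ← hoe, h])
  have hli : LinearIndependent F u := by
    rw [linearIndependent_iff']
    intro s c hs e he
    have h0 := congrFun (congrArg Subtype.val hs) (Sum.inl (o e))
    rw [AddSubmonoidClass.coe_finsetSum, Finset.sum_apply, Finset.sum_eq_single e] at h0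
    · exact (mul_eq_zero.1 h0).resolve_right (ho e).1
    · intro e' _ hne
      have := (ho e').2 (o e) fun h => hne (hinj h).symm
      simp [this]
    · exact fun h => (h he).elim
  have : Fintype Γ.edgeSet := Fintype.ofFinite _
  have hle := hli.fintype_card_le_finrank
  rw [← Nat.card_eq_fintype_card] at hle
  omega

theorem nonedgeMask_eq_zero_iff {W : Type*} {G : SimpleGraph W}
    {z : nonedgeForms F (⊥ : SimpleGraph W)} :
    nonedgeMask F G z = 0 ↔ ∀ q : W × W, ¬ G.Adj q.1 q.2 → z.1 q = 0 := by
  constructor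
  · intro h q hq
    have := congrFun (congrArg Subtype.val h) q
    rwa [nonedgeMask_apply, if_neg hq] at this
  · intro h
    ext q
    rw [nonedgeMask_apply]
    split_ifs with hq
    · rfl
    · exact h q hq

/-- The forms spanned by `u ∧ v` for vectors `u`, `v` in `U`. -/
def wedgeSpan {W : Type*} (U : Submodule F (W → F)) :
    Submodule F (nonedgeForms F (⊥ : SimpleGraph W)) :=
  Submodule.span F {z | ∃ u ∈ U, ∃ v ∈ U, wedge F u v = z}

/-- The row of `u ∧ v` at `x` is `u x • v - v x • u`. -/
theorem row_mem_of_mem_wedgeSpan {W : Type*} {U : Submodule F (W → F)}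
    {z : nonedgeForms F (⊥ : SimpleGraph W)} (hz : z ∈ wedgeSpan U) (x : W) :
    (fun y => z.1 (x, y)) ∈ U := by
  induction hz using Submodule.span_induction with
  | mem z hz =>
    obtain ⟨u, hu, v, hv, rfl⟩ := hz
    convert U.sub_mem (U.smul_mem (u x) hv) (U.smul_mem (v x) hu) using 1
    ext y
    simp [mul_comm]
  | zero => exact U.zero_mem
  | add y z _ _ hy hz => exact U.add_mem hy hz
  | smul c z _ hz => exact U.smul_mem c hz

/-- Only entries at links over `e` are at stake. If `z` is nonzero at such a link `(o, o')`, its row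
at `o` lies in `U`. As `o'` is the only external neighbour of `o`, the row vanishes at all other
external vertices and isolates `o'`, against freeness of `e`. -/
theorem nonedgeMask_eq_zero_of_mem_freeEdges {T T' : Set (Sym2 V)} {e : Sym2 V}
    (hT : ∀ e', e' ≠ e → (e' ∈ T ↔ e' ∈ T')) {U : Submodule F (CFIVertex Γ → F)}
    (he : e ∈ freeEdges U) {z : nonedgeForms F (⊥ : SimpleGraph (CFIVertex Γ))}
    (hz : z ∈ wedgeSpan U) (h : nonedgeMask F (CFIGraphTwistedAt Γ T) z = 0) :
    nonedgeMask F (CFIGraphTwistedAt Γ T') z = 0 := by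
  rw [nonedgeMask_eq_zero_iff] at h ⊢
  rintro ⟨x, y⟩ hxy
  by_cases hadj : (CFIGraphTwistedAt Γ T).Adj x y
  · rcases x with o | i <;> rcases y with o' | j
    · have hlink : CFILinkAdj Γ T o o' := hadj
      have hoe : o.1.edge = e := by
        by_contra hne
        exact hxy ⟨hlink.1, by rw [← hT _ hne]; exact hlink.2⟩
      by_contra hne
      refine he.2 _ (row_mem_of_mem_wedgeSpan hz (Sum.inl o)) o' ⟨hne, fun o'' ho'' => ?_⟩ ?_
      · refine h (Sum.inl o, Sum.inl o'') fun hadj' => ho'' ?_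
        have h1 := cfiLinkAdj_iff.1 hlink
        have h2 := cfiLinkAdj_iff.1 (show CFILinkAdj Γ T o o'' from hadj')
        exact Prod.ext (h2.1.trans h1.1.symm) (add_left_cancel (h2.2.trans h1.2.symm))
      · rw [hlink.1, SimpleGraph.Dart.edge_symm, hoe]
    · exact (hxy hadj).elim
    · exact (hxy hadj).elim
    · exact hadj.elim
  · exact h _ hadj

/-- Over a free edge, a twist does not change the cocycle on `U` up to isomorphism. -/
theorem exists_equiv_meklerCocycle_of_mem_freeEdges [Finite V] {e : Sym2 V}
    {U : Submodule F (CFIVertex Γ → F)} (he : e ∈ freeEdges U) :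
    ∃ γ : nonedgeForms F (CFIGraph Γ) ≃ₗ[F] nonedgeForms F (twistedCFIGraph Γ e),
      ∀ u ∈ U, ∀ v ∈ U, γ (meklerCocycle F (CFIGraph Γ) u v) =
        meklerCocycle F (twistedCFIGraph Γ e) u v := by
  have : Finite Γ.Dart := Finite.of_injective _ SimpleGraph.Dart.toProd_injective
  obtain ⟨ε⟩ := nonempty_nonedgeForms_equiv F he.1
  have hT : ∀ e', e' ≠ e → (e' ∈ (∅ : Set (Sym2 V)) ↔ e' ∈ ({e} : Set (Sym2 V))) := by simp
  -- Here `ε` only supplies equality of dimensions; `γ` comes from the equal kernels of the masks on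
  -- `wedgeSpan U`.
  obtain ⟨γ, hγ⟩ := exists_linearEquiv_comp_eq (L := wedgeSpan U) ε
    ((nonedgeMask F (CFIGraph Γ)).domRestrict (wedgeSpan U))
    ((nonedgeMask F (twistedCFIGraph Γ e)).domRestrict (wedgeSpan U)) <| by
      ext z
      exact ⟨nonedgeMask_eq_zero_of_mem_freeEdges hT he z.2,
        nonedgeMask_eq_zero_of_mem_freeEdges (fun e' h => (hT e' h).symm) he z.2⟩
  refine ⟨γ, fun u hu v hv => ?_⟩
  rw [meklerCocycle_apply, meklerCocycle_apply, map_smul]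
  exact congrArg _ (hγ ⟨wedge F u v, Submodule.subset_span ⟨u, hu, v, hv, rfl⟩⟩)

/-- An isomorphism of graphs induces an isomorphism of cocycles. -/
theorem exists_equiv_meklerCocycle_of_equiv {W W' : Type*} {G : SimpleGraph W}
    {G' : SimpleGraph W'} (φ : W ≃ W') (hφ : ∀ x y, G'.Adj (φ x) (φ y) ↔ G.Adj x y) :
    ∃ γ : nonedgeForms F G ≃ₗ[F] nonedgeForms F G', ∀ u v, γ (meklerCocycle F G u v) =
      meklerCocycle F G' (LinearEquiv.funCongrLeft F F φ.symm u)
        (LinearEquiv.funCongrLeft F F φ.symm v) := by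
  have hswap : ∀ q : W × W, φ.prodCongr φ q.swap = (φ.prodCongr φ q).swap := by simp
  have hadj : ∀ q : W × W, G'.Adj (φ.prodCongr φ q).1 (φ.prodCongr φ q).2 ↔ G.Adj q.1 q.2 := by
    simp [hφ]
  refine ⟨nonedgeFormsCongr F (φ.prodCongr φ) hswap hadj, fun u v => ?_⟩
  rw [meklerCocycle_apply, meklerCocycle_apply, map_smul]
  congr 1
  ext q
  have h := hφ (φ.symm q.1) (φ.symm q.2)
  rw [φ.apply_symm_apply, φ.apply_symm_apply] at h
  rw [nonedgeFormsCongr_apply, nonedgeMask_apply, nonedgeMask_apply]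
  classical exact if_congr h.symm rfl rfl

end FreeEdges

/-! ### Gluing the isomorphisms into a bijection -/

/-- A permutation may be chosen pointwise according to an invariant. -/
theorem bijective_of_invariant {X I : Type*} (ρ : X → I) (g : I → X → X)
    (hg : ∀ i, Function.Bijective (g i)) (hρ : ∀ i x, ρ (g i x) = ρ x) :
    Function.Bijective fun x => g (ρ x) x := by
  refine ⟨fun x y hxy => ?_, fun y => ?_⟩
  · have h : ρ x = ρ y := by
      have := congrArg ρ hxy
      simpa only [hρ] using this
    simp only [h] at hxy
    exact (hg _).1 hxy
  · obtain ⟨x, hx⟩ := (hg (ρ y)).2 y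
    have h : ρ x = ρ y := by rw [← hρ (ρ y) x, hx]
    exact ⟨x, by simp only [h, hx]⟩

/-- The central extensions of a CFI graph and its twist have equal `k`-subgroup profiles when
`k` is less than the number of edges. -/
theorem haveEqualSubgroupProfiles_cfi {V : Type*} [Finite V] {Γ : SimpleGraph V}
    [Γ.LocallyFinite] (hconn : Γ.Connected) {e : Sym2 V} (he : e ∈ Γ.edgeSet) (F : Type*)
    [Field F] {k : ℕ} (hk : k < Nat.card Γ.edgeSet) :
    HaveEqualSubgroupProfiles k (BilinExt (meklerCocycle F (CFIGraph Γ)))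
      (BilinExt (meklerCocycle F (twistedCFIGraph Γ e))) := by
  -- The flip depends on the set `s` of free edges and not on `U` itself. Without a free edge the
  -- zero flip is taken, since the map must be a bijection on all subspaces, including large ones.
  have hflip : ∀ s : Set (Sym2 V), ∃ f : {f : Γ.Dart → ZMod 2 // IsEvenFlip f},
      s.Nonempty → s ⊆ Γ.edgeSet → ∃ e' ∈ s, ∀ d : Γ.Dart, f.1 d + f.1 d.symm =
        ({e'} : Set (Sym2 V)).indicator 1 d.edge + ({e} : Set (Sym2 V)).indicator 1 d.edge := by
    intro s
    by_cases hs : s.Nonempty ∧ s ⊆ Γ.edgeSet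
    · obtain ⟨⟨e', he'⟩, hs⟩ := hs
      obtain ⟨f, hf, hf'⟩ := twistMoves_of_connected hconn (hs he') he
      exact ⟨⟨f, hf⟩, fun _ _ => ⟨e', he', hf'⟩⟩
    · exact ⟨⟨0, fun v => by simp⟩, fun h h' => (hs ⟨h, h'⟩).elim⟩
  choose f hf using hflip
  refine BilinExt.haveEqualSubgroupProfiles _ _ k
    (fun U => flipEquiv F (f (freeEdges U)).1 (f (freeEdges U)).2) ?_ fun U hU => ?_
  · exact bijective_of_invariant freeEdges
      (fun s U => U.map (flipEquiv F (f s).1 (f s).2 : (CFIVertex Γ → F) →ₗ[F] (CFIVertex Γ → F)))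
      (fun s => (Submodule.orderIsoMapComap (flipEquiv F (f s).1 (f s).2)).bijective)
      fun s U => freeEdges_map_flipEquiv _ _ U
  · obtain ⟨e', he', hf'⟩ := hf (freeEdges U) (freeEdges_nonempty (hU.trans_lt hk)) fun _ h => h.1
    obtain ⟨γ, hγ⟩ := exists_equiv_meklerCocycle_of_mem_freeEdges he'
    obtain ⟨δ, hδ⟩ := exists_equiv_meklerCocycle_of_equiv (F := F)
      (G := twistedCFIGraph Γ e') (G' := twistedCFIGraph Γ e)
      (cfiFlip (f (freeEdges U)).1 (f (freeEdges U)).2) (cfiFlip_adj_iff _ hf')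
    -- First `γ` introduces the twist at the free edge `e'`, then `δ` moves it to `e`.
    refine ⟨γ.trans δ, fun u hu v hv => ?_⟩
    rw [LinearEquiv.trans_apply, hγ u hu v hv]
    exact hδ u v

theorem mainTheorem7 {V : Type*} [Fintype V] [DecidableEq V]
    (Γ₀ : SimpleGraph V) [DecidableRel Γ₀.Adj]
    (hreg : Γ₀.IsRegularOfDegree 3) (hconn : Γ₀.Connected)
    (e : Sym2 V) (he : e ∈ Γ₀.edgeSet)
    (p : ℕ) (hp : p.Prime) (hodd : p ≠ 2)
    (k : ℕ) (hk : (k : ℚ) < (Γ₀.edgeFinset.card : ℚ) / 10) :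
    HaveEqualSubgroupProfiles k
      (MeklerGroup p (CFIGraph Γ₀)) (MeklerGroup p (twistedCFIGraph Γ₀ e)) := by
  classical
  have : Fact p.Prime := ⟨hp⟩
  have hlt : k < Nat.card Γ₀.edgeSet := by
    rw [Nat.card_eq_fintype_card, ← SimpleGraph.edgeFinset_card]
    have h : (0 : ℚ) ≤ Γ₀.edgeFinset.card := Nat.cast_nonneg _
    have h' : (k : ℚ) < Γ₀.edgeFinset.card := by linarith
    exact_mod_cast h'
  exact (haveEqualSubgroupProfiles_cfi hconn he (ZMod p) hlt).congr
    (MeklerGroup.equivModel _ hodd) (MeklerGroup.equivModel _ hodd)
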